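/- All groups are finite. For a finite group $X$ let $\mathrm H^2(X,\mathbb C^\times)$ be its second cohomology group with trivial action on $\mathbb C^\times$, and for a $2$-cocycle $\alpha$ let $\mathbb C^\alpha X$ be the twisted group algebra, with $\mathbb C$-basis $\{\bar x : x\in X\}$ and multiplication $\bar x\,\bar y=\alpha(x,y)\,\overline{xy}$. Write $X\sim_{\mathbb C}Y$ via $\phi$ if $\phi:\mathrm H^2(X,\mathbb C^\times)\to \mathrm H^2(Y,\mathbb C^\times)$ is an isomorphism of groups such that $\mathbb C^\alpha X\cong\mathbb C^{\phi(\alpha)}Y$ as $\mathbb C$-algebras for every $[\alpha]\in \mathrm H^2(X,\mathbb C^\times)$ (where $\phi(\alpha)$ denotes any cocycle in the class $\phi([\alpha])$), and $X\sim_{\mathbb C}Y$ if there is such a $\phi$. For a central subgroup $Z$ of $X$, the transgression $\mathrm{tra}:\mathrm{Hom}(Z,\mathbb C^\times)\to \mathrm H^2(X/Z,\mathbb C^\times)$ sends $\chi$ to the class of $(x,y)\mapsto\chi\big(\mu(x)\mu(y)\mu(xy)^{-1}\big)$, where $\mu$ is any section of $X\to X/Z$. A group $X$ is a central product of its normal subgroups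 $X_1$ and $X_2$ if $X=X_1X_2$ and $[X_1,X_2]=1$. **Theorem 1.5.** Let $G$ be a finite group that is a central product of its normal subgroups $G_1$ and $G_2$, and let $H$ be a finite group that is a central product of its normal subgroups $H_1$ and $H_2$. Put $Z_1=G_1'\cap G_2'$ and $Z_2=H_1'\cap H_2'$, where $'$ denotes the derived subgroup (these are central subgroups of $G$ and $H$), and let $\mathrm{tra}_1:\mathrm{Hom}(Z_1,\mathbb C^\times)\to \mathrm H^2(G/Z_1,\mathbb C^\times)$ and $\mathrm{tra}_2:\mathrm{Hom}(Z_2,\mathbb C^\times)\to \mathrm H^2(H/Z_2,\mathbb C^\times)$ be the transgression maps. Suppose that $G/Z_1\sim_{\mathbb C}H/Z_2$ via $\bar\phi$, and that there is an isomorphism of groups $\bar i:\mathrm{Hom}(Z_1,\mathbb C^\times)\to\mathrm{Hom}(Z_2,\mathbb C^\times)$ with $$\bar\phi\circ\mathrm{tra}_1=\mathrm{tra}_2\circ\bar i .$$ Then $G\sim_{\mathbb C}H$. -/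

import Mathlib

open groupCohomology
open scoped commutatorElement

noncomputable section

/-- The unit group `Rˣ` as a trivial `G`-module (written additively), so that
`H2 (unitsRep R G)` is `H²(G, Rˣ)` and `cocycles₂ (unitsRep R G)` is `Z²(G, Rˣ)`. -/
abbrev unitsRep (R G : Type) [CommRing R] [Group G] : Rep ℤ G :=
  Rep.trivial ℤ G (Additive Rˣ)

section Cocycles

variable {R G : Type} [CommRing R] [Group G]

/-- The value `α(g, h) ∈ Rˣ` of a 2-cocycle, written multiplicatively. -/
def cocycleVal (α : cocycles₂ (unitsRep R G)) (g h : G) : Rˣ :=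
  Additive.toMul (α (g, h) : Additive Rˣ)

/-- The multiplicative 2-cocycle identity for the trivial action. -/
theorem cocycleVal_mul (α : cocycles₂ (unitsRep R G)) (g h k : G) :
    cocycleVal α g h * cocycleVal α (g * h) k = cocycleVal α h k * cocycleVal α g (h * k) := by
  have := (mem_cocycles₂_iff (A := unitsRep R G) α.1).1 α.2 g h k
  rw [mul_comm]
  exact congrArg (Additive.toMul (α := Rˣ)) this

theorem cocycleVal_one_left (α : cocycles₂ (unitsRep R G)) (g : G) :
    cocycleVal α 1 g = cocycleVal α 1 1 := by
  have := cocycleVal_mul α 1 1 g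
  simp only [one_mul] at this
  exact (mul_right_cancel this).symm

theorem cocycleVal_one_right (α : cocycles₂ (unitsRep R G)) (g : G) :
    cocycleVal α g 1 = cocycleVal α 1 1 := by
  have := cocycleVal_mul α g 1 1
  simp only [mul_one] at this
  exact mul_right_cancel this

/-- A function `f : G → G → Rˣ` satisfying the multiplicative 2-cocycle identity, as an element
of `Z²(G, Rˣ)`. -/
def mkCocycle (f : G → G → Rˣ)
    (hf : ∀ g h k, f g h * f (g * h) k = f h k * f g (h * k)) : cocycles₂ (unitsRep R G) :=
  ⟨fun p => Additive.ofMul (f p.1 p.2), (mem_cocycles₂_iff (A := unitsRep R G) _).2 fun g h k =>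
    congrArg Additive.ofMul ((mul_comm _ _).trans (hf g h k))⟩

end Cocycles

section TwistedGroupAlgebra

variable {R G : Type} [CommRing R] [Group G]

/-- The twisted group ring `R^α G`: the free `R`-module with basis `ḡ` (`g ∈ G`), with
multiplication `ḡ * h̄ = α(g, h) • (gh)‾`. -/
def TwistedGroupAlgebra (_α : cocycles₂ (unitsRep R G)) : Type := G →₀ R

namespace TwistedGroupAlgebra

variable (α : cocycles₂ (unitsRep R G))

instance : AddCommGroup (TwistedGroupAlgebra α) := inferInstanceAs (AddCommGroup (G →₀ R))

instance : Module R (TwistedGroupAlgebra α) := inferInstanceAs (Module R (G →₀ R))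

/-- `single α g r` is the element `r • ḡ`; the basis element `ḡ` is `single α g 1`. -/
def single (g : G) (r : R) : TwistedGroupAlgebra α := Finsupp.single g r

/-- The bilinear extension of `ḡ * h̄ = α(g, h) • (gh)‾`. -/
def mulHom : TwistedGroupAlgebra α →ₗ[R] TwistedGroupAlgebra α →ₗ[R] TwistedGroupAlgebra α :=
  Finsupp.linearCombination R (M := TwistedGroupAlgebra α →ₗ[R] TwistedGroupAlgebra α) fun g : G =>
    Finsupp.linearCombination R (M := TwistedGroupAlgebra α) fun h : G =>
      single α (g * h) (cocycleVal α g h : R)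

instance : Mul (TwistedGroupAlgebra α) := ⟨fun x y => mulHom α x y⟩

/-- The unit element is `α(1, 1)⁻¹ • 1̄`, since cocycles are not assumed to be normalized. -/
instance : One (TwistedGroupAlgebra α) := ⟨single α 1 (((cocycleVal α 1 1)⁻¹ : Rˣ) : R)⟩

theorem mul_def (x y : TwistedGroupAlgebra α) : x * y = mulHom α x y := rfl

theorem one_def : (1 : TwistedGroupAlgebra α) = single α 1 (((cocycleVal α 1 1)⁻¹ : Rˣ) : R) := rfl

theorem smul_single (g : G) (a b : R) : a • single α g b = single α g (a * b) :=
  Finsupp.smul_single' a g b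

theorem single_mul_single (g h : G) (a b : R) :
    single α g a * single α h b = single α (g * h) (a * b * (cocycleVal α g h : R)) := by
  have h1 : mulHom α (single α g a) = a •
      (Finsupp.linearCombination R (M := TwistedGroupAlgebra α) fun h : G =>
      single α (g * h) (cocycleVal α g h : R)) :=
    Finsupp.linearCombination_single R a g
  have h2 : (Finsupp.linearCombination R (M := TwistedGroupAlgebra α) fun h : G =>
      single α (g * h) (cocycleVal α g h : R)) (single α h b) =
        b • single α (g * h) (cocycleVal α g h : R) :=
    Finsupp.linearCombination_single R b h
  rw [mul_def, h1]
  refine (congrArg (a • ·) h2).trans ?_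
  simp only [smul_single, mul_assoc]

theorem induction {p : TwistedGroupAlgebra α → Prop} (x : TwistedGroupAlgebra α) (h0 : p 0)
    (hadd : ∀ x y, p x → p y → p (x + y)) (hs : ∀ g r, p (single α g r)) : p x :=
  Finsupp.induction_linear (motive := p) x h0 hadd hs

instance : Ring (TwistedGroupAlgebra α) where
  __ := (inferInstance : AddCommGroup (TwistedGroupAlgebra α))
  left_distrib x y z := map_add (mulHom α x) y z
  right_distrib x y z := LinearMap.map_add₂ (mulHom α) x y z
  zero_mul x := LinearMap.map_zero₂ (mulHom α) x
  mul_zero x := map_zero (mulHom α x)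
  mul_assoc x y z := by
    have add1 : ∀ u v w : TwistedGroupAlgebra α, (u + v) * w = u * w + v * w :=
      fun u v w => LinearMap.map_add₂ (mulHom α) u v w
    have add2 : ∀ u v w : TwistedGroupAlgebra α, u * (v + w) = u * v + u * w :=
      fun u v w => map_add (mulHom α u) v w
    have z1 : ∀ u : TwistedGroupAlgebra α, 0 * u = 0 := fun u => LinearMap.map_zero₂ (mulHom α) u
    have z2 : ∀ u : TwistedGroupAlgebra α, u * 0 = 0 := fun u => map_zero (mulHom α u)
    induction x using induction with
    | h0 => simp only [z1]
    | hadd a b ha hb => simp only [add1, ha, hb]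
    | hs g a =>
      induction y using induction with
      | h0 => simp only [z1, z2]
      | hadd u v hu hv => simp only [add1, add2, hu, hv]
      | hs h b =>
        induction z using induction with
        | h0 => simp only [z2]
        | hadd u v hu hv => simp only [add2, hu, hv]
        | hs k c =>
          simp only [single_mul_single]
          have e := congrArg (Units.val (α := R)) (cocycleVal_mul α g h k)
          simp only [Units.val_mul] at e
          rw [mul_assoc g h k]
          congr 1
          linear_combination (a * b * c) * e
  one_mul x := by
    induction x using induction with
    | h0 => exact map_zero (mulHom α 1)
    | hadd a b ha hb =>
      have : (1 : TwistedGroupAlgebra α) * (a + b) = 1 * a + 1 * b := map_add (mulHom α 1) a b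
      rw [this, ha, hb]
    | hs g a =>
      rw [one_def, single_mul_single, one_mul, cocycleVal_one_left α g]
      congr 1
      rw [mul_comm _ a, mul_assoc, Units.inv_mul, mul_one]
  mul_one x := by
    induction x using induction with
    | h0 => exact LinearMap.map_zero₂ (mulHom α) 1
    | hadd a b ha hb =>
      have : (a + b) * (1 : TwistedGroupAlgebra α) = a * 1 + b * 1 :=
        LinearMap.map_add₂ (mulHom α) a b 1
      rw [this, ha, hb]
    | hs g a =>
      rw [one_def, single_mul_single, mul_one, cocycleVal_one_right α g]
      congr 1
      rw [mul_assoc, Units.inv_mul, mul_one]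

instance : Algebra R (TwistedGroupAlgebra α) :=
  Algebra.ofModule
    (fun r x y => LinearMap.map_smul₂ (mulHom α) r x y)
    (fun r x y => map_smul (mulHom α x) r y)

end TwistedGroupAlgebra

end TwistedGroupAlgebra

/-- `G ∼_R H` via the isomorphism `φ : H²(G, Rˣ) → H²(H, Rˣ)`: for every class `[α]`, the
`R`-algebras `R^α G` and `R^{φ(α)} H` are isomorphic. Here `β` ranges over the
cocycles representing the class `φ([α])`. -/
def TwistedEquivVia {R G H : Type} [CommRing R] [Group G] [Group H]
    (φ : H2 (unitsRep R G) ≃+ H2 (unitsRep R H)) : Prop :=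
  ∀ (α : cocycles₂ (unitsRep R G)) (β : cocycles₂ (unitsRep R H)),
    φ (H2π (unitsRep R G) α) = H2π (unitsRep R H) β →
      Nonempty (TwistedGroupAlgebra α ≃ₐ[R] TwistedGroupAlgebra β)

/-- The relation `G ∼_R H`. -/
def TwistedEquiv (R G H : Type) [CommRing R] [Group G] [Group H] : Prop :=
  ∃ φ : H2 (unitsRep R G) ≃+ H2 (unitsRep R H), TwistedEquivVia φ

section Transgression

variable {R G : Type} [CommRing R] [Group G] {Z : Subgroup G} [Z.Normal]

/-- For a section `μ` of `G → G ⧸ Z`, the element `μ(x) μ(y) μ(xy)⁻¹` of `Z`. -/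
def sectionDefect (μ : G ⧸ Z → G) (hμ : ∀ x, (μ x : G ⧸ Z) = x) (x y : G ⧸ Z) : Z :=
  ⟨μ x * μ y * (μ (x * y))⁻¹, by
    rw [← QuotientGroup.eq_one_iff]
    simp [hμ]⟩

theorem sectionDefect_mul (hZ : Z ≤ Subgroup.center G) (μ : G ⧸ Z → G)
    (hμ : ∀ x, (μ x : G ⧸ Z) = x) (x y z : G ⧸ Z) :
    sectionDefect μ hμ x y * sectionDefect μ hμ (x * y) z =
      sectionDefect μ hμ y z * sectionDefect μ hμ x (y * z) := by
  have hc := Subgroup.mem_center_iff.1 (hZ (sectionDefect μ hμ y z).2) (μ x)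
  apply Subtype.ext
  simp only [sectionDefect, Subgroup.coe_mul] at hc ⊢
  rw [← mul_assoc (μ y * μ z * (μ (y * z))⁻¹), ← mul_assoc (μ y * μ z * (μ (y * z))⁻¹), ← hc,
    mul_assoc x y z]
  group

/-- The cocycle `α_χ(x, y) = χ(μ(x) μ(y) μ(xy)⁻¹)` attached to the central extension
`1 → Z → G → G ⧸ Z → 1`, a section `μ` and a homomorphism `χ : Z → Rˣ`. -/
def transgressionCocycle (hZ : Z ≤ Subgroup.center G) (μ : G ⧸ Z → G)
    (hμ : ∀ x, (μ x : G ⧸ Z) = x) (χ : Z →* Rˣ) : cocycles₂ (unitsRep R (G ⧸ Z)) :=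
  mkCocycle (fun x y => χ (sectionDefect μ hμ x y)) fun x y z => by
    rw [← map_mul, ← map_mul, sectionDefect_mul hZ]

/-- The class of `α_χ` does not depend on the section. -/
theorem transgressionCocycle_class (hZ : Z ≤ Subgroup.center G) (μ ν : G ⧸ Z → G)
    (hμ : ∀ x, (μ x : G ⧸ Z) = x) (hν : ∀ x, (ν x : G ⧸ Z) = x) (χ : Z →* Rˣ) :
    H2π (unitsRep R (G ⧸ Z)) (transgressionCocycle hZ μ hμ χ) =
      H2π (unitsRep R (G ⧸ Z)) (transgressionCocycle hZ ν hν χ) := by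
  have hd : ∀ x, μ x * (ν x)⁻¹ ∈ Z := fun x => by
    rw [← QuotientGroup.eq_one_iff]; simp [hμ, hν]
  let d : G ⧸ Z → Z := fun x => ⟨μ x * (ν x)⁻¹, hd x⟩
  have key : ∀ x y,
      sectionDefect μ hμ x y = d y * (d (x * y))⁻¹ * d x * sectionDefect ν hν x y := by
    intro x y
    have cen : ∀ (a : Z) (g : G), g * (a : G) = a * g := fun a g =>
      Subgroup.mem_center_iff.1 (hZ a.2) g
    have hm : ∀ t, μ t = d t * ν t := fun t => by simp [d]
    apply Subtype.ext
    simp only [Subgroup.coe_mul, Subgroup.coe_inv]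
    simp only [sectionDefect]
    rw [hm x, hm y, hm (x * y), mul_inv_rev]
    have hi : ∀ g : G, g * ((d (x * y) : G))⁻¹ = ((d (x * y) : G))⁻¹ * g := fun g => by
      have := cen (d (x * y))⁻¹ g
      simpa using this
    calc (d x : G) * ν x * (d y * ν y) * ((ν (x * y))⁻¹ * (d (x * y) : G)⁻¹)
        = ((d x : G) * ν x * d y * ν y * (ν (x * y))⁻¹) * (d (x * y) : G)⁻¹ := by group
      _ = (d (x * y) : G)⁻¹ * ((d x : G) * ν x * d y * ν y * (ν (x * y))⁻¹) := hi _
      _ = (d (x * y) : G)⁻¹ * (((d x : G) * ν x) * d y * ν y * (ν (x * y))⁻¹) := rfl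
      _ = (d (x * y) : G)⁻¹ * ((d y * ((d x : G) * ν x)) * ν y * (ν (x * y))⁻¹) := by
          rw [cen (d y) (d x * ν x)]
      _ = ((d (x * y) : G)⁻¹ * d y) * (d x * (ν x * ν y * (ν (x * y))⁻¹)) := by group
      _ = (d y * (d (x * y) : G)⁻¹) * (d x * (ν x * ν y * (ν (x * y))⁻¹)) := by rw [hi]
      _ = _ := by group
  rw [H2π_eq_iff]
  refine ⟨fun x => Additive.ofMul (χ (d x)), ?_⟩
  funext ⟨x, y⟩
  change Additive.ofMul (χ (d y) / χ (d (x * y)) * χ (d x)) =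
    Additive.ofMul (χ (sectionDefect μ hμ x y) / χ (sectionDefect ν hν x y))
  rw [key]
  simp [div_eq_mul_inv]

/-- The transgression map `tra : Hom(Z, Rˣ) → H²(G ⧸ Z, Rˣ)`, `χ ↦ [α_χ]`, of the central
extension `1 → Z → G → G ⧸ Z → 1` (computed with some chosen section). -/
def transgression (hZ : Z ≤ Subgroup.center G) (χ : Z →* Rˣ) : H2 (unitsRep R (G ⧸ Z)) :=
  H2π (unitsRep R (G ⧸ Z)) (transgressionCocycle hZ Quotient.out QuotientGroup.out_eq' χ)

end Transgression

/-- `G` is the central product of its subgroups `G₁` and `G₂` (amalgamating `G₁ ∩ G₂`):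
`G = G₁ G₂` and `[G₁, G₂] = 1`. -/
structure IsCentralProduct {G : Type} [Group G] (G₁ G₂ : Subgroup G) : Prop where
  exists_mul : ∀ g : G, ∃ a ∈ G₁, ∃ b ∈ G₂, a * b = g
  commutator_eq : ⁅G₁, G₂⁆ = ⊥

/-- The subgroup `G₁' ∩ G₂'` of `G`. -/
abbrev derivedInter {G : Type} [Group G] (G₁ G₂ : Subgroup G) : Subgroup G :=
  ⁅G₁, G₁⁆ ⊓ ⁅G₂, G₂⁆

theorem IsCentralProduct.derivedInter_le_center {G : Type} [Group G] {G₁ G₂ : Subgroup G}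
    (h : IsCentralProduct G₁ G₂) : derivedInter G₁ G₂ ≤ Subgroup.center G := by
  intro z hz
  have hle : ∀ K : Subgroup G, ⁅K, K⁆ ≤ K := fun K =>
    Subgroup.commutator_le.2 fun a ha b hb =>
      K.mul_mem (K.mul_mem (K.mul_mem ha hb) (K.inv_mem ha)) (K.inv_mem hb)
  have h1 := hle _ hz.1
  have h2 := hle _ hz.2
  have hc : ∀ a ∈ G₁, ∀ b ∈ G₂, a * b = b * a := fun a ha b hb => by
    have : ⁅a, b⁆ ∈ ⁅G₁, G₂⁆ := Subgroup.commutator_mem_commutator ha hb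
    rw [h.commutator_eq, Subgroup.mem_bot] at this
    exact commutatorElement_eq_one_iff_mul_comm.1 this
  rw [Subgroup.mem_center_iff]
  intro g
  obtain ⟨a, ha, b, hb, rfl⟩ := h.exists_mul g
  rw [mul_assoc, ← hc z h1 b hb, ← mul_assoc, hc a ha z h2, mul_assoc]

end

/-! Two facts about a central subgroup `Z` of `G` carry the argument. First, the kernel of inflation
from `G ⧸ Z` to `G` on H² is the image of transgression (`inflation_eq_zero_iff`). Second, over ℂ
the twisted group algebra of an inflated cocycle `a` splits, by Fourier analysis along `Z`, into the
product over the characters `χ` of `Z` of the twisted group algebras of `G ⧸ Z` for `a + tra χ`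
(`TwistedGroupAlgebra.nonempty_algEquiv_pi`).

The central product enters through surjectivity of inflation for `Z = G₁' ∩ G₂'`
(`IsCentralProduct.inflation_surjective`). For commuting elements the quotient `α(a, b) / α(b, a)`
is multiplicative in `a`, so it dies on commutators of elements commuting with `b`. As `z ∈ Z` lies
in both derived subgroups, it pairs trivially with `G₂` and with `G₁`, hence with `G`. The
restriction of `α` to `Z` is then symmetric, hence a coboundary, and `α` can be corrected to a
cocycle constant on `Z`-cosets.

Thus H² of `G` is H² of `G ⧸ Z₁` modulo the image of `tra₁`, and likewise for `H`. The compatibility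
with `i` makes `φ` descend to these quotients, and it sends the translates `a + tra₁ χ` to `φ(a) +
tra₂ (i χ)`, so the two product decompositions match factor by factor. -/

noncomputable section

/-! ### Cohomologous cocycles in multiplicative form -/

section Cocycles

variable {R G : Type} [CommRing R] [Group G]

@[simp]
theorem cocycleVal_add (α β : cocycles₂ (unitsRep R G)) (x y : G) :
    cocycleVal (α + β) x y = cocycleVal α x y * cocycleVal β x y := rfl

/-- Two cocycles are cohomologous if and only if they differ by the coboundary of a cochain. -/
theorem H2π_eq_iff_exists_cochain (α β : cocycles₂ (unitsRep R G)) :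
    H2π (unitsRep R G) α = H2π (unitsRep R G) β ↔
      ∃ f : G → Rˣ, ∀ x y,
        cocycleVal α x y * f (x * y) = f x * f y * cocycleVal β x y := by
  rw [H2π_eq_iff]
  have key : ∀ a b u v w : Rˣ, v / w * u = a / b ↔ a * w = u * v * b := fun a b u v w => by
    constructor
    · intro h
      rw [← div_mul_cancel a b, ← h]
      simp only [div_eq_mul_inv]
      calc v * w⁻¹ * u * b * w = (w⁻¹ * w) * (u * v * b) := by
            simp only [mul_comm, mul_left_comm, mul_assoc]
        _ = _ := by simp
    · intro h
      rw [eq_div_iff_mul_eq', ← mul_left_inj w, h]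
      simp only [div_eq_mul_inv]
      calc v * w⁻¹ * u * b * w = (w⁻¹ * w) * (u * v * b) := by
            simp only [mul_comm, mul_left_comm, mul_assoc]
        _ = _ := by simp
  constructor
  · rintro ⟨f, hf⟩
    refine ⟨fun x => Additive.toMul (f x : Additive Rˣ), fun x y => ?_⟩
    exact (key _ _ _ _ _).1 (congrArg (Additive.toMul (α := Rˣ)) (congrFun hf (x, y)))
  · rintro ⟨f, hf⟩
    refine ⟨fun x => Additive.ofMul (f x), ?_⟩
    funext ⟨x, y⟩
    exact congrArg Additive.ofMul ((key _ _ _ _ _).2 (hf x y))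

theorem H2π_surjective : Function.Surjective (H2π (unitsRep R G)) := fun c =>
  H2_induction_on c fun a => ⟨a, rfl⟩

end Cocycles

/-! ### Homomorphisms between twisted group algebras -/

namespace TwistedGroupAlgebra

variable {R G : Type} [CommRing R] [Group G]

/-- An algebra homomorphism out of `R^α G` from a family of elements multiplying according
to `α`. -/
def lift (α : cocycles₂ (unitsRep R G)) {A : Type} [Ring A] [Algebra R A] (u : G → A)
    (hone : u 1 = algebraMap R A (cocycleVal α 1 1 : R))
    (hmul : ∀ x y, u x * u y = (cocycleVal α x y : R) • u (x * y)) :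
    TwistedGroupAlgebra α →ₐ[R] A :=
  let L : TwistedGroupAlgebra α →ₗ[R] A := Finsupp.linearCombination R u
  have hL : ∀ g r, L (single α g r) = r • u g := fun g r => Finsupp.linearCombination_single R r g
  AlgHom.ofLinearMap L
    (by
      rw [one_def, hL, hone, Algebra.smul_def, ← map_mul, Units.inv_mul, map_one])
    (fun x y => by
      induction x using induction with
      | h0 => simp
      | hadd a b ha hb => rw [add_mul, map_add, ha, hb, map_add, add_mul]
      | hs g a =>
        induction y using induction with
        | h0 => simp
        | hadd c d hc hd => rw [mul_add, map_add, hc, hd, map_add, mul_add]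
        | hs h b =>
          rw [single_mul_single, hL, hL, hL, smul_mul_smul_comm, hmul, smul_smul])

theorem lift_single (α : cocycles₂ (unitsRep R G)) {A : Type} [Ring A] [Algebra R A] (u : G → A)
    (hone : u 1 = algebraMap R A (cocycleVal α 1 1 : R))
    (hmul : ∀ x y, u x * u y = (cocycleVal α x y : R) • u (x * y)) (g : G) (r : R) :
    lift α u hone hmul (single α g r) = r • u g :=
  Finsupp.linearCombination_single R r g

theorem algebraMap_eq (α : cocycles₂ (unitsRep R G)) (r : R) :
    algebraMap R (TwistedGroupAlgebra α) r =
      single α 1 (r * (((cocycleVal α 1 1)⁻¹ : Rˣ) : R)) := by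
  rw [Algebra.algebraMap_eq_smul_one, one_def, smul_single]

/-- The homomorphism `R^α G → R^β H` sending `ḡ` to `f(g)` times the basis element of `π(g)`. -/
def map {H : Type} [Group H] {α : cocycles₂ (unitsRep R G)} {β : cocycles₂ (unitsRep R H)}
    (π : G →* H) (f : G → Rˣ)
    (hf : ∀ x y, cocycleVal α x y * f (x * y) = f x * f y * cocycleVal β (π x) (π y)) :
    TwistedGroupAlgebra α →ₐ[R] TwistedGroupAlgebra β :=
  lift α (fun g => single β (π g) (f g : R))
    (by
      have h := hf 1 1
      rw [mul_one, mul_comm, mul_assoc, mul_right_inj, map_one] at h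
      rw [algebraMap_eq, h, map_one, ← Units.val_mul, mul_assoc, mul_inv_cancel, mul_one])
    (fun x y => by
      rw [single_mul_single, smul_single, map_mul, ← Units.val_mul, ← Units.val_mul,
        ← Units.val_mul, ← hf])

theorem map_single {H : Type} [Group H] {α : cocycles₂ (unitsRep R G)}
    {β : cocycles₂ (unitsRep R H)} (π : G →* H) (f : G → Rˣ)
    (hf : ∀ x y, cocycleVal α x y * f (x * y) = f x * f y * cocycleVal β (π x) (π y))
    (g : G) (r : R) : map π f hf (single α g r) = single β (π g) (r * f g) := by
  rw [map, lift_single, smul_single]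

theorem algHom_ext {α : cocycles₂ (unitsRep R G)} {A : Type} [Ring A] [Algebra R A]
    {F K : TwistedGroupAlgebra α →ₐ[R] A} (h : ∀ g r, F (single α g r) = K (single α g r)) :
    F = K := by
  ext x
  induction x using induction with
  | h0 => simp
  | hadd a b ha hb => rw [map_add, map_add, ha, hb]
  | hs g r => exact h g r

/-- Cohomologous cocycles have isomorphic twisted group algebras. -/
theorem nonempty_algEquiv_of_H2π_eq {α β : cocycles₂ (unitsRep R G)}
    (h : H2π (unitsRep R G) α = H2π (unitsRep R G) β) :
    Nonempty (TwistedGroupAlgebra α ≃ₐ[R] TwistedGroupAlgebra β) := by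
  obtain ⟨f, hf⟩ := (H2π_eq_iff_exists_cochain α β).1 h
  have hf' : ∀ x y, cocycleVal β x y * (f (x * y))⁻¹ = (f x)⁻¹ * (f y)⁻¹ * cocycleVal α x y := by
    intro x y
    rw [mul_inv_eq_iff_eq_mul, mul_assoc, hf, ← mul_inv, inv_mul_cancel_left]
  refine ⟨AlgEquiv.ofAlgHom (map (MonoidHom.id G) f hf)
    (map (MonoidHom.id G) (fun g => (f g)⁻¹) hf') ?_ ?_⟩ <;>
  · refine algHom_ext fun g r => ?_
    simp [map_single, mul_assoc]

/-- The coefficient of `x` at the basis element `ḡ`. -/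
def coeff (α : cocycles₂ (unitsRep R G)) (g : G) : TwistedGroupAlgebra α →ₗ[R] R :=
  Finsupp.lapply g

theorem coeff_single [DecidableEq G] (α : cocycles₂ (unitsRep R G)) (g h : G) (r : R) :
    coeff α h (single α g r) = if g = h then r else 0 := by
  classical
  refine (Finsupp.single_apply (a := g) (a' := h) (b := r)).trans ?_
  split_ifs <;> rfl

theorem ext_coeff {α : cocycles₂ (unitsRep R G)} {x y : TwistedGroupAlgebra α}
    (h : ∀ g, coeff α g x = coeff α g y) : x = y :=
  Finsupp.ext h

instance [Finite G] (α : cocycles₂ (unitsRep R G)) : Module.Finite R (TwistedGroupAlgebra α) :=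
  inferInstanceAs (Module.Finite R (G →₀ R))

instance [Nontrivial R] (α : cocycles₂ (unitsRep R G)) : Nontrivial (TwistedGroupAlgebra α) :=
  inferInstanceAs (Nontrivial (G →₀ R))

end TwistedGroupAlgebra

/-! ### Inflation and its kernel -/

section Inflation

variable {R G : Type} [CommRing R] [Group G] (Z : Subgroup G) [Z.Normal]

/-- Inflation of 2-cocycles along `G → G ⧸ Z`. -/
def inflationCocycle : cocycles₂ (unitsRep R (G ⧸ Z)) →+ cocycles₂ (unitsRep R G) where
  toFun a := mkCocycle (fun x y => cocycleVal a x y) fun x y z => by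
    simpa only [QuotientGroup.mk_mul] using cocycleVal_mul a x y z
  map_zero' := rfl
  map_add' _ _ := rfl

@[simp]
theorem cocycleVal_inflationCocycle (a : cocycles₂ (unitsRep R (G ⧸ Z))) (x y : G) :
    cocycleVal (inflationCocycle Z a) x y = cocycleVal a (x : G ⧸ Z) (y : G ⧸ Z) := rfl

/-- Inflation `H²(G ⧸ Z, Rˣ) → H²(G, Rˣ)`. -/
def inflation : H2 (unitsRep R (G ⧸ Z)) →+ H2 (unitsRep R G) :=
  (H2π (unitsRep R (G ⧸ Z))).hom.toAddMonoidHom.liftOfSurjective H2π_surjective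
    ⟨(H2π (unitsRep R G)).hom.toAddMonoidHom.comp (inflationCocycle Z), fun a ha => by
      have ha' : H2π (unitsRep R (G ⧸ Z)) a = H2π (unitsRep R (G ⧸ Z)) 0 :=
        (show H2π (unitsRep R (G ⧸ Z)) a = 0 from ha).trans (_root_.map_zero _).symm
      obtain ⟨f, hf⟩ := (H2π_eq_iff_exists_cochain _ _).1 ha'
      refine (show H2π (unitsRep R G) (inflationCocycle Z a) = 0 from ?_)
      rw [← _root_.map_zero (H2π (unitsRep R G)).hom, ← _root_.map_zero (inflationCocycle Z)]
      exact (H2π_eq_iff_exists_cochain _ _).2 ⟨fun g => f g, fun x y => hf x y⟩⟩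

theorem inflation_H2π (a : cocycles₂ (unitsRep R (G ⧸ Z))) :
    inflation Z (H2π (unitsRep R (G ⧸ Z)) a) = H2π (unitsRep R G) (inflationCocycle Z a) :=
  AddMonoidHom.liftOfRightInverse_comp_apply _ _ _ _ a

variable {Z}

theorem mul_out_inv_mem (g : G) : g * ((g : G ⧸ Z).out)⁻¹ ∈ Z := by
  rw [← QuotientGroup.eq_one_iff]; simp

/-- The `Z`-component of `g` relative to the chosen section of `G → G ⧸ Z`. -/
def fiberPart (Z : Subgroup G) [Z.Normal] (g : G) : Z :=
  ⟨g * ((g : G ⧸ Z).out)⁻¹, mul_out_inv_mem g⟩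

theorem fiberPart_mul_out (g : G) : (fiberPart Z g : G) * (g : G ⧸ Z).out = g := by
  simp [fiberPart]

theorem fiberPart_mul_left (z : Z) (g : G) : fiberPart Z (z * g) = z * fiberPart Z g := by
  have : ((z * g : G) : G ⧸ Z) = g := by
    rw [QuotientGroup.mk_mul, (QuotientGroup.eq_one_iff (z : G)).2 z.2, one_mul]
  apply Subtype.ext
  simp [fiberPart, this, mul_assoc]

/-- After inflation to `G` the section defect becomes the coboundary of the `Z`-valued cochain
`fiberPart`, up to sign. This both kills inflated transgressions and produces the projections of the
algebra decomposition. -/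
theorem fiberPart_mul (hZ : Z ≤ Subgroup.center G) (g h : G) :
    fiberPart Z (g * h) = fiberPart Z g * fiberPart Z h *
      sectionDefect Quotient.out QuotientGroup.out_eq' (g : G ⧸ Z) (h : G ⧸ Z) := by
  have cen : ∀ (a : Z) (g : G), g * (a : G) = a * g := fun a g =>
    Subgroup.mem_center_iff.1 (hZ a.2) g
  apply Subtype.ext
  have hg := fiberPart_mul_out (Z := Z) g
  have hh := fiberPart_mul_out (Z := Z) h
  have h1 : (fiberPart Z (g * h) : G) = g * h * (((g : G ⧸ Z) * (h : G ⧸ Z)).out)⁻¹ := rfl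
  rw [h1]
  simp only [Subgroup.coe_mul, sectionDefect]
  calc g * h * _ = ((fiberPart Z g : G) * (g : G ⧸ Z).out) *
        (fiberPart Z h * (h : G ⧸ Z).out) * (((g : G ⧸ Z) * (h : G ⧸ Z)).out)⁻¹ := by rw [hg, hh]
    _ = (fiberPart Z g : G) * ((g : G ⧸ Z).out * fiberPart Z h) * (h : G ⧸ Z).out *
        (((g : G ⧸ Z) * (h : G ⧸ Z)).out)⁻¹ := by simp only [mul_assoc]
    _ = _ := by rw [cen]; simp only [mul_assoc]

theorem inflation_transgression (hZ : Z ≤ Subgroup.center G) (χ : Z →* Rˣ) :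
    inflation Z (transgression (R := R) hZ χ) = 0 := by
  rw [transgression, inflation_H2π, ← _root_.map_zero (H2π (unitsRep R G)).hom]
  refine (H2π_eq_iff_exists_cochain _ _).2 ⟨fun g => (χ (fiberPart Z g))⁻¹, fun x y => ?_⟩
  change χ (sectionDefect Quotient.out QuotientGroup.out_eq' (x : G ⧸ Z) (y : G ⧸ Z)) *
    (χ (fiberPart Z (x * y)))⁻¹ = (χ (fiberPart Z x))⁻¹ * (χ (fiberPart Z y))⁻¹ * 1
  rw [fiberPart_mul hZ, mul_one, map_mul, map_mul, mul_inv_rev, mul_inv_cancel_left, mul_inv]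

/-- If the inflation of `a` is the coboundary of `f` on `G`, then `f` restricted to `Z` is a
character up to a constant, and `f` transforms under `Z` by that character. Evaluating `f` on the
section then compares `a` with a transgression. -/
theorem exists_transgression_of_inflation_eq_zero (hZ : Z ≤ Subgroup.center G)
    (c : H2 (unitsRep R (G ⧸ Z))) (hc : inflation Z c = 0) :
    ∃ χ : Z →* Rˣ, transgression hZ χ = c := by
  obtain ⟨a, rfl⟩ := H2π_surjective c
  rw [inflation_H2π, ← _root_.map_zero (H2π (unitsRep R G)).hom] at hc
  obtain ⟨f, hf⟩ := (H2π_eq_iff_exists_cochain _ _).1 hc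
  -- The cocycle need not be normalized: `f 1 = k`, so `f` must be divided by `k` to give a
  -- character on `Z`.
  set k := cocycleVal a 1 1
  have hf' : ∀ x y : G, cocycleVal a (x : G ⧸ Z) (y : G ⧸ Z) * f (x * y) = f x * f y :=
    fun x y => (hf x y).trans (mul_one _)
  have hz : ∀ (z : Z) (g : G), k * f (z * g) = f z * f g := fun z g => by
    rw [← hf', (QuotientGroup.eq_one_iff (z : G)).2 z.2, cocycleVal_one_left]
  let χ : Z →* Rˣ := MonoidHom.mk' (fun z => f z * k⁻¹) fun z w => by
    have := hz z w
    rw [Subgroup.coe_mul, eq_inv_mul_of_mul_eq this]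
    simp only [mul_comm, mul_left_comm, mul_assoc]
  have hχ : ∀ (z : Z) (g : G), f (z * g) = χ z * f g := fun z g => by
    rw [eq_inv_mul_of_mul_eq (hz z g)]
    simp only [χ, MonoidHom.mk'_apply, mul_comm, mul_assoc]
  -- From `f(x.out) f(y.out) = a(x, y) f(x.out y.out)`, where the last factor is `χ(defect)
  -- f((xy).out)`, the cocycle `a` is a coboundary times `χ⁻¹(defect)`; hence the inverse.
  refine ⟨χ⁻¹, ?_⟩
  refine (H2π_eq_iff_exists_cochain _ _).2 ⟨fun x => (f x.out)⁻¹, fun x y => ?_⟩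
  change (χ (sectionDefect Quotient.out QuotientGroup.out_eq' x y))⁻¹ * (f (x * y).out)⁻¹ = _
  rw [← mul_inv, ← hχ]
  have h := hf' x.out y.out
  rw [QuotientGroup.out_eq', QuotientGroup.out_eq'] at h
  simp only [sectionDefect, inv_mul_cancel_right]
  rw [← mul_inv, eq_inv_mul_iff_mul_eq, ← h, mul_inv_cancel_right]

theorem inflation_eq_zero_iff (hZ : Z ≤ Subgroup.center G) (c : H2 (unitsRep R (G ⧸ Z))) :
    inflation Z c = 0 ↔ ∃ χ : Z →* Rˣ, transgression hZ χ = c :=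
  ⟨exists_transgression_of_inflation_eq_zero hZ c,
    fun ⟨χ, h⟩ => h ▸ inflation_transgression hZ χ⟩

end Inflation

/-! ### The commutator pairing of a cocycle -/

section CommutatorPairing

variable {R G : Type} [CommRing R] [Group G] (α : cocycles₂ (unitsRep R G))

/-- The commutator pairing `α(a, b) / α(b, a)` is multiplicative in `a` on the centralizer
of `b`. -/
theorem cocycleVal_div_mul {a a' b : G} (h : Commute a b) (h' : Commute a' b) :
    cocycleVal α (a * a') b / cocycleVal α b (a * a') =
      (cocycleVal α a b / cocycleVal α b a) * (cocycleVal α a' b / cocycleVal α b a') := by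
  have h1 := cocycleVal_mul α a a' b
  have h2 := cocycleVal_mul α b a a'
  have h3 := cocycleVal_mul α a b a'
  rw [h'.eq] at h1
  rw [h.eq] at h3
  rw [div_mul_div_comm, div_eq_div_iff_mul_eq_mul]
  -- These are the auxiliary factors of the cocycle identities for `(a, a', b)`, `(b, a, a')` and
  -- `(a, b, a')`; once they are inserted, the goal is a product of the three identities.
  apply mul_left_cancel (a := cocycleVal α a a' * cocycleVal α (b * a) a' *
    cocycleVal α a (b * a'))
  calc _ = (cocycleVal α a a' * cocycleVal α (a * a') b) *
        (cocycleVal α b a * cocycleVal α (b * a) a') *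
          (cocycleVal α b a' * cocycleVal α a (b * a')) := by
        simp only [mul_comm, mul_left_comm]
    _ = _ := by
        rw [h1, h2, ← h3]
        simp only [mul_comm, mul_left_comm]

/-- The commutator pairing with `b` as a homomorphism on the centralizer of `b`. -/
def commutatorPairing (b : G) : Subgroup.centralizer {b} →* Rˣ :=
  MonoidHom.mk' (fun a => cocycleVal α a b / cocycleVal α b a) fun a a' =>
    cocycleVal_div_mul α (Subgroup.mem_centralizer_singleton_iff.1 a.2)
      (Subgroup.mem_centralizer_singleton_iff.1 a'.2)

/-- Pairing with `b` is a homomorphism from the centralizer of `b`, which contains `K`, to an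
abelian group, so it is trivial on commutators of elements of `K`. -/
theorem cocycleVal_comm_of_mem_commutator {K : Subgroup G} {b z : G}
    (hb : ∀ a ∈ K, a * b = b * a) (hz : z ∈ ⁅K, K⁆) :
    cocycleVal α z b = cocycleVal α b z := by
  have hle : ⁅K, K⁆ ≤ (commutatorPairing α b).ker.map (Subgroup.centralizer {b}).subtype := by
    refine Subgroup.commutator_le.2 fun x hx y hy => ?_
    have mem : ∀ a ∈ K, a ∈ Subgroup.centralizer {b} := fun a ha =>
      Subgroup.mem_centralizer_singleton_iff.2 (hb a ha)
    refine ⟨⁅(⟨x, mem x hx⟩ : Subgroup.centralizer {b}), ⟨y, mem y hy⟩⁆, ?_, rfl⟩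
    rw [SetLike.mem_coe, MonoidHom.mem_ker, map_commutatorElement,
      commutatorElement_eq_one_iff_mul_comm, mul_comm]
  obtain ⟨w, hw, rfl⟩ := hle hz
  exact div_eq_one.1 (MonoidHom.mem_ker.1 hw)

theorem IsCentralProduct.commute {G₁ G₂ : Subgroup G} (h : IsCentralProduct G₁ G₂) :
    ∀ a ∈ G₁, ∀ b ∈ G₂, a * b = b * a := fun a ha b hb => by
  have : ⁅a, b⁆ ∈ ⁅G₁, G₂⁆ := Subgroup.commutator_mem_commutator ha hb
  rw [h.commutator_eq, Subgroup.mem_bot] at this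
  exact commutatorElement_eq_one_iff_mul_comm.1 this

/-- Lying in `G₁'` makes `z` pair trivially with `G₂`, lying in `G₂'` makes it pair trivially with
`G₁`, and multiplicativity extends this to the products `a * b`. -/
theorem IsCentralProduct.cocycleVal_comm {G₁ G₂ : Subgroup G} (h : IsCentralProduct G₁ G₂)
    {z : G} (hz : z ∈ derivedInter G₁ G₂) (g : G) :
    cocycleVal α z g = cocycleVal α g z := by
  obtain ⟨a, ha, b, hb, rfl⟩ := h.exists_mul g
  have h1 : cocycleVal α z b = cocycleVal α b z :=
    cocycleVal_comm_of_mem_commutator α (fun x hx => h.commute x hx b hb) hz.1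
  have h2 : cocycleVal α z a = cocycleVal α a z :=
    cocycleVal_comm_of_mem_commutator α (fun x hx => (h.commute a ha x hx).symm) hz.2
  have hc : ∀ g, Commute g z := fun g =>
    Subgroup.mem_center_iff.1 (h.derivedInter_le_center hz) g
  have := cocycleVal_div_mul α (hc a) (hc b)
  rw [h1, h2, div_self', div_self', mul_one, div_eq_one] at this
  exact this.symm

end CommutatorPairing

/-! ### Surjectivity of inflation -/

section Surjectivity

variable {k G : Type} [Field k] [Group G]

/-- Over an algebraically closed field, a symmetric 2-cocycle on a finite group is a
coboundary: a point of the commutative twisted group algebra gives the required cochain. -/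
theorem exists_cochain_of_symmetric [IsAlgClosed k] {A : Type} [Group A] [Finite A]
    (hA : ∀ x y : A, x * y = y * x)
    (α : cocycles₂ (unitsRep k A)) (hα : ∀ x y, cocycleVal α x y = cocycleVal α y x) :
    ∃ s : A → kˣ, ∀ x y, s x * s y = cocycleVal α x y * s (x * y) := by
  let _ : CommRing (TwistedGroupAlgebra α) :=
    { (inferInstance : Ring (TwistedGroupAlgebra α)) with
      mul_comm := fun x y => by
        induction x using TwistedGroupAlgebra.induction with
        | h0 => rw [zero_mul, mul_zero]
        | hadd a b ha hb => rw [add_mul, mul_add, ha, hb]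
        | hs g a =>
          induction y using TwistedGroupAlgebra.induction with
          | h0 => rw [zero_mul, mul_zero]
          | hadd a b ha hb => rw [add_mul, mul_add, ha, hb]
          | hs h b =>
            rw [TwistedGroupAlgebra.single_mul_single, TwistedGroupAlgebra.single_mul_single,
              hA g h, hα g h, mul_comm a b] }
  -- The residue field at a maximal ideal is finite over the algebraically closed field `k`, hence
  -- equal to it. This gives a character `ψ` of the algebra, and its values on the basis are the
  -- cochain.
  obtain ⟨M, hM⟩ := Ideal.exists_maximal (TwistedGroupAlgebra α)
  let _ : Field (TwistedGroupAlgebra α ⧸ M) := Ideal.Quotient.field M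
  let q : TwistedGroupAlgebra α →ₐ[k] TwistedGroupAlgebra α ⧸ M := Ideal.Quotient.mkₐ k M
  have : Module.Finite k (TwistedGroupAlgebra α ⧸ M) :=
    Module.Finite.of_surjective q.toLinearMap (Ideal.Quotient.mkₐ_surjective k M)
  have hbij := IsAlgClosed.algebraMap_bijective_of_isIntegral (k := k)
    (K := TwistedGroupAlgebra α ⧸ M)
  let e : k ≃ₐ[k] TwistedGroupAlgebra α ⧸ M := AlgEquiv.ofBijective (Algebra.ofId _ _) hbij
  let ψ : TwistedGroupAlgebra α →ₐ[k] k := (e.symm : _ →ₐ[k] k).comp q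
  have hmul : ∀ x y, ψ (TwistedGroupAlgebra.single α x 1) * ψ (TwistedGroupAlgebra.single α y 1) =
      cocycleVal α x y * ψ (TwistedGroupAlgebra.single α (x * y) 1) := fun x y => by
    rw [← map_mul, TwistedGroupAlgebra.single_mul_single, ← smul_eq_mul (cocycleVal α x y : k),
      ← map_smul, TwistedGroupAlgebra.smul_single, one_mul, one_mul, mul_one]
  -- Basis elements are invertible: the product of those at `x` and `x⁻¹` is a nonzero scalar
  -- multiple of the identity.
  have hne : ∀ x, ψ (TwistedGroupAlgebra.single α x 1) ≠ 0 := fun x h0 => by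
    have h1 := hmul x x⁻¹
    have h2 : ψ 1 = 1 := map_one ψ
    rw [TwistedGroupAlgebra.one_def, ← mul_one (((cocycleVal α 1 1)⁻¹ : kˣ) : k),
      ← TwistedGroupAlgebra.smul_single, map_smul, smul_eq_mul] at h2
    rw [h0, zero_mul, mul_inv_cancel, eq_comm, mul_eq_zero] at h1
    rcases h1 with h1 | h1
    · exact (cocycleVal α x x⁻¹).ne_zero h1
    · rw [h1, mul_zero] at h2
      exact zero_ne_one h2
  exact ⟨fun x => Units.mk0 _ (hne x), fun x y => Units.ext (hmul x y)⟩

/-- The coboundary of a 1-cochain. -/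
def coboundaryCocycle {R : Type} [CommRing R] (f : G → Rˣ) : cocycles₂ (unitsRep R G) :=
  mkCocycle (fun g h => f g * f h * (f (g * h))⁻¹) fun g h k => by
    rw [mul_assoc (f g) (f h), mul_right_comm, mul_comm (f g * _), mul_assoc g h k,
      mul_assoc (f (g * h)), mul_left_comm]
    simp only [mul_left_comm, mul_assoc, mul_inv_cancel_left]

/-- A cocycle that commutes with a central subgroup `Z` and is trivial on it is cohomologous to
an inflated one. -/
theorem exists_inflation_eq_of_cochain {R : Type} [CommRing R] {Z : Subgroup G} [Z.Normal]
    (hZ : Z ≤ Subgroup.center G)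
    (α : cocycles₂ (unitsRep R G)) (hα : ∀ (z : Z) (g : G), cocycleVal α z g = cocycleVal α g z)
    (s : Z → Rˣ) (hs : ∀ z w : Z, s z * s w = cocycleVal α (z : G) w * s (z * w)) :
    ∃ c, inflation Z c = H2π (unitsRep R G) α := by
  -- The cochain is forced by the wish that `α` times its coboundary be constant on `Z`-cosets: `f`
  -- must satisfy the transformation law `hf` under `Z`, so it is determined by its values on the
  -- section, here `α(1, x.out) / s(1) = 1`.
  let f : G → Rˣ := fun g => (s (fiberPart Z g))⁻¹ *
    cocycleVal α (fiberPart Z g : G) (g : G ⧸ Z).out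
  have hmk : ∀ (z : Z) (g : G), ((z * g : G) : G ⧸ Z) = g := fun z g => by
    rw [QuotientGroup.mk_mul, (QuotientGroup.eq_one_iff (z : G)).2 z.2, one_mul]
  have hf : ∀ (z : Z) (g : G), f (z * g) = (s z)⁻¹ * cocycleVal α z g * f g := by
    intro z g
    have h1 := hs z (fiberPart Z g)
    have h2 := cocycleVal_mul α z (fiberPart Z g) (g : G ⧸ Z).out
    rw [fiberPart_mul_out] at h2
    simp only [f, fiberPart_mul_left, hmk, Subgroup.coe_mul]
    have h3 : (s (z * fiberPart Z g))⁻¹ =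
        (s z)⁻¹ * (s (fiberPart Z g))⁻¹ * cocycleVal α (z : G) (fiberPart Z g) := by
      rw [← mul_inv, h1, mul_inv, mul_comm, mul_inv_cancel_left]
    rw [h3, mul_assoc, h2]
    simp only [mul_comm, mul_left_comm, mul_assoc]
  let γ : G → G → Rˣ := cocycleVal (α + coboundaryCocycle f)
  have γ_def : ∀ g h, γ g h = cocycleVal α g h * (f g * f h * (f (g * h))⁻¹) := fun g h => rfl
  have hγ : ∀ g h k, γ g h * γ (g * h) k = γ h k * γ g (h * k) :=
    cocycleVal_mul (α + coboundaryCocycle f)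
  clear_value γ f
  have hleft : ∀ (z : Z) (g h : G), γ (z * g) h = γ g h := fun z g h => by
    have := cocycleVal_mul α z g h
    rw [γ_def, γ_def]
    rw [mul_assoc (z : G) g h, hf z g, hf z (g * h), ← mul_assoc, ← mul_assoc, mul_inv_eq_iff_eq_mul]
    calc _ = (cocycleVal α z g * cocycleVal α (z * g) h) * ((s z)⁻¹ * f g * f h) := by
          simp only [mul_comm, mul_left_comm, mul_assoc]
      _ = (cocycleVal α g h * cocycleVal α z (g * h)) * ((s z)⁻¹ * f g * f h) *
            ((f (g * h))⁻¹ * f (g * h)) := by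
          rw [this, inv_mul_cancel, mul_one]
      _ = _ := by simp only [mul_comm, mul_left_comm, mul_assoc]
  -- Unlike invariance in the first variable, this uses that `Z` is central and that `α` commutes
  -- with it, to move `z` past `g`.
  have hright : ∀ (z : Z) (g h : G), γ g (z * h) = γ g h := fun z g h => by
    have e : g * (z * h) = z * (g * h) := by
      rw [← mul_assoc, Subgroup.mem_center_iff.1 (hZ z.2) g, mul_assoc]
    have h1 := cocycleVal_mul α g z h
    have h2 := cocycleVal_mul α z g h
    rw [Subgroup.mem_center_iff.1 (hZ z.2) g, ← hα, h2] at h1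
    rw [γ_def, γ_def]
    rw [e, hf z h, hf z (g * h), ← mul_assoc, ← mul_assoc, mul_inv_eq_iff_eq_mul]
    calc _ = (cocycleVal α z h * cocycleVal α g (z * h)) * ((s z)⁻¹ * f g * f h) := by
          simp only [mul_comm, mul_left_comm, mul_assoc]
      _ = (cocycleVal α g h * cocycleVal α z (g * h)) * ((s z)⁻¹ * f g * f h) *
            ((f (g * h))⁻¹ * f (g * h)) := by
          rw [h1, inv_mul_cancel, mul_one]
      _ = _ := by simp only [mul_comm, mul_left_comm, mul_assoc]
  have hout : ∀ g h : G, γ (g : G ⧸ Z).out (h : G ⧸ Z).out = γ g h := fun g h => by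
    rw [← hleft (fiberPart Z g), ← hright (fiberPart Z h), fiberPart_mul_out, fiberPart_mul_out]
  let b : cocycles₂ (unitsRep R (G ⧸ Z)) := mkCocycle (fun x y => γ x.out y.out) fun x y z => by
    have e : ∀ x y w : G ⧸ Z, γ (x * y).out w.out = γ (x.out * y.out) w.out := fun x y w => by
      have := hout (x.out * y.out) w.out
      simpa only [QuotientGroup.mk_mul, QuotientGroup.out_eq'] using this
    have e' : ∀ x y w : G ⧸ Z, γ w.out (x * y).out = γ w.out (x.out * y.out) := fun x y w => by
      have := hout w.out (x.out * y.out)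
      simpa only [QuotientGroup.mk_mul, QuotientGroup.out_eq'] using this
    rw [e, e']
    exact hγ _ _ _
  refine ⟨H2π _ b, ?_⟩
  rw [inflation_H2π]
  refine (H2π_eq_iff_exists_cochain _ _).2 ⟨f, fun x y => ?_⟩
  change γ (x : G ⧸ Z).out (y : G ⧸ Z).out * f (x * y) = _
  rw [hout, γ_def, ← mul_assoc, inv_mul_cancel_right, mul_comm]

/-- Inflation is surjective for the amalgamated derived subgroups of a central product. -/
theorem IsCentralProduct.inflation_surjective [IsAlgClosed k] [Finite G] {G₁ G₂ : Subgroup G}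
    [G₁.Normal] [G₂.Normal] (h : IsCentralProduct G₁ G₂) :
    Function.Surjective (inflation (R := k) (derivedInter G₁ G₂)) := by
  intro c
  obtain ⟨α, rfl⟩ := H2π_surjective c
  let ρ : cocycles₂ (unitsRep k (derivedInter G₁ G₂)) :=
    mkCocycle (fun z w => cocycleVal α (z : G) (w : G)) fun x y z => cocycleVal_mul α x y z
  obtain ⟨s, hs⟩ := exists_cochain_of_symmetric
    (fun x y => Subtype.ext (Subgroup.mem_center_iff.1 (h.derivedInter_le_center y.2) x)) ρ
    (fun x y => h.cocycleVal_comm α x.2 y)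
  exact exists_inflation_eq_of_cochain h.derivedInter_le_center α
    (fun z g => h.cocycleVal_comm α z.2 g) s hs

end Surjectivity

/-! ### Fourier decomposition along a central subgroup -/

section Decomposition

/-- Orthogonality of the characters of a finite abelian group. -/
theorem sum_monoidHom_apply {k A : Type} [Field k] [IsAlgClosed k] [CharZero k] [CommGroup A]
    [Finite A] [Fintype (A →* kˣ)] [DecidableEq A] (a : A) :
    ∑ χ : A →* kˣ, (χ a : k) = if a = 1 then (Nat.card A : k) else 0 := by
  split_ifs with ha
  · subst ha
    simp [← CommGroup.card_monoidHom_of_hasEnoughRootsOfUnity A k]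
  · obtain ⟨ψ, hψ⟩ := CommGroup.exists_apply_ne_one_of_hasEnoughRootsOfUnity A k ha
    -- Multiplication by `ψ` permutes the characters, so the sum is fixed by the scalar `ψ a ≠ 1`
    -- and must vanish.
    have h : (ψ a : k) * ∑ χ : A →* kˣ, (χ a : k) = ∑ χ : A →* kˣ, (χ a : k) := by
      rw [Finset.mul_sum]
      exact Fintype.sum_equiv (Equiv.mulLeft ψ) _ _ fun χ => rfl
    by_contra h0
    exact hψ (Units.ext ((mul_eq_right₀ h0).1 h))

theorem TwistedGroupAlgebra.finrank_eq {k G : Type} [Field k] [Group G] [Finite G]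
    (α : cocycles₂ (unitsRep k G)) : Module.finrank k (TwistedGroupAlgebra α) = Nat.card G := by
  have := Fintype.ofFinite G
  rw [Nat.card_eq_fintype_card]
  exact Module.finrank_finsupp_self k

variable {R G : Type} [CommRing R] [Group G] {Z : Subgroup G} [Z.Normal]

/-- The component at `χ` of the decomposition of the twisted group algebra of an inflated
cocycle. -/
def TwistedGroupAlgebra.inflationProj (hZ : Z ≤ Subgroup.center G)
    (a : cocycles₂ (unitsRep R (G ⧸ Z))) (χ : Z →* Rˣ) :
    TwistedGroupAlgebra (inflationCocycle Z a) →ₐ[R] TwistedGroupAlgebra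
      (a + transgressionCocycle hZ Quotient.out QuotientGroup.out_eq' χ) :=
  TwistedGroupAlgebra.map (QuotientGroup.mk' Z) (fun g => χ (fiberPart Z g)) fun x y => by
    rw [fiberPart_mul hZ, map_mul, map_mul, cocycleVal_inflationCocycle, cocycleVal_add]
    exact mul_left_comm _ _ _

theorem TwistedGroupAlgebra.inflationProj_single (hZ : Z ≤ Subgroup.center G)
    (a : cocycles₂ (unitsRep R (G ⧸ Z))) (χ : Z →* Rˣ) (g : G) (r : R) :
    inflationProj hZ a χ (single _ g r) = single _ (g : G ⧸ Z) (r * χ (fiberPart Z g)) :=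
  map_single _ _ _ _ _

variable {k : Type} [Field k] [IsAlgClosed k] [CharZero k] [Finite G]

/-- Fourier inversion for the family `inflationProj`. -/
theorem TwistedGroupAlgebra.sum_coeff_inflationProj (hZ : Z ≤ Subgroup.center G)
    [Fintype (Z →* kˣ)] (a : cocycles₂ (unitsRep k (G ⧸ Z)))
    (x : TwistedGroupAlgebra (inflationCocycle Z a)) (g : G) :
    ∑ χ : Z →* kˣ, (χ (fiberPart Z g)⁻¹ : k) * coeff _ (g : G ⧸ Z) (inflationProj hZ a χ x) =
      Nat.card Z * coeff _ g x := by
  classical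
  induction x using induction with
  | h0 => simp
  | hadd x y hx hy => simp only [map_add, mul_add, Finset.sum_add_distrib, hx, hy]
  | hs h r =>
    simp only [inflationProj_single, coeff_single]
    -- Elements outside the coset of `g` contribute nothing; within the coset, orthogonality of
    -- characters singles out `h = g`.
    by_cases hgh : (h : G ⧸ Z) = g
    · let _ : CommGroup Z :=
        { (inferInstance : Group Z) with
          mul_comm := fun x y => Subtype.ext (Subgroup.mem_center_iff.1 (hZ y.2) x) }
      have h1 : ∀ χ : Z →* kˣ, (χ (fiberPart Z g)⁻¹ : k) * (r * χ (fiberPart Z h)) =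
          r * χ ((fiberPart Z g)⁻¹ * fiberPart Z h) := fun χ => by
        rw [map_mul, Units.val_mul]; ring
      simp only [hgh, if_true, h1, ← Finset.mul_sum]
      rw [sum_monoidHom_apply]
      have h2 : (fiberPart Z g)⁻¹ * fiberPart Z h = 1 ↔ h = g := by
        rw [inv_mul_eq_one]
        refine ⟨fun e => ?_, fun e => by rw [e]⟩
        rw [← fiberPart_mul_out (Z := Z) h, ← fiberPart_mul_out (Z := Z) g, e, hgh]
      simp only [h2]
      split_ifs <;> ring
    · have : h ≠ g := fun e => hgh (by rw [e])
      simp [hgh, this]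

/-- The twisted group algebra of an inflated cocycle decomposes as the product, over the
characters `χ` of the central subgroup, of the twisted group algebras of the quotient for the
translates by `tra(χ)`. -/
theorem TwistedGroupAlgebra.nonempty_algEquiv_pi (hZ : Z ≤ Subgroup.center G)
    (a : cocycles₂ (unitsRep k (G ⧸ Z))) :
    Nonempty (TwistedGroupAlgebra (inflationCocycle Z a) ≃ₐ[k]
      ∀ χ : Z →* kˣ, TwistedGroupAlgebra
        (a + transgressionCocycle hZ Quotient.out QuotientGroup.out_eq' χ)) := by
  classical
  let _ : CommGroup Z :=
    { (inferInstance : Group Z) with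
      mul_comm := fun x y => Subtype.ext (Subgroup.mem_center_iff.1 (hZ y.2) x) }
  have hcard : Nat.card (Z →* kˣ) = Nat.card Z :=
    CommGroup.card_monoidHom_of_hasEnoughRootsOfUnity Z k
  have : Finite (Z →* kˣ) := Nat.finite_of_card_ne_zero (hcard ▸ Nat.card_pos.ne')
  have := Fintype.ofFinite (Z →* kˣ)
  let D := AlgHom.pi (R := k) (fun χ : Z →* kˣ => inflationProj hZ a χ)
  -- Fourier inversion recovers every coefficient up to the factor `|Z|`, which is nonzero in
  -- characteristic zero.
  have hinj : Function.Injective D.toLinearMap := fun x y hxy => by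
    refine ext_coeff fun g => ?_
    have hZ0 : (Nat.card Z : k) ≠ 0 := Nat.cast_ne_zero.2 Nat.card_pos.ne'
    refine mul_left_cancel₀ hZ0 ?_
    rw [← sum_coeff_inflationProj hZ, ← sum_coeff_inflationProj hZ]
    have h : ∀ χ, inflationProj hZ a χ x = inflationProj hZ a χ y := fun χ => congrFun hxy χ
    simp only [h]
  -- Both sides have dimension `|G| = |Z| · |G ⧸ Z|`, so injectivity suffices.
  have hrank : Module.finrank k (TwistedGroupAlgebra (inflationCocycle Z a)) =
      Module.finrank k (∀ χ : Z →* kˣ, TwistedGroupAlgebra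
        (a + transgressionCocycle hZ Quotient.out QuotientGroup.out_eq' χ)) := by
    rw [Module.finrank_pi_fintype]
    simp only [finrank_eq, Finset.sum_const, Finset.card_univ, smul_eq_mul]
    rw [← Nat.card_eq_fintype_card, hcard, mul_comm, Z.card_eq_card_quotient_mul_card_subgroup]
  exact ⟨AlgEquiv.ofBijective D ⟨hinj,
    (LinearMap.injective_iff_surjective_of_finrank_eq_finrank hrank).1 hinj⟩⟩

end Decomposition

end

/-! ### The main theorem -/

theorem theorem1p5 (G H : Type) [Group G] [Finite G] [Group H] [Finite H]
    (G₁ G₂ : Subgroup G) [G₁.Normal] [G₂.Normal]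
    (H₁ H₂ : Subgroup H) [H₁.Normal] [H₂.Normal]
    (hG : IsCentralProduct G₁ G₂) (hH : IsCentralProduct H₁ H₂)
    (φ : H2 (unitsRep ℂ (G ⧸ derivedInter G₁ G₂)) ≃+ H2 (unitsRep ℂ (H ⧸ derivedInter H₁ H₂)))
    (hφ : TwistedEquivVia φ)
    (i : (derivedInter G₁ G₂ →* ℂˣ) ≃* (derivedInter H₁ H₂ →* ℂˣ))
    (hcomm : ∀ χ : derivedInter G₁ G₂ →* ℂˣ,
      φ (transgression hG.derivedInter_le_center χ) =
        transgression hH.derivedInter_le_center (i χ)) :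
    TwistedEquiv ℂ G H := by
  have hsG := hG.inflation_surjective (k := ℂ)
  have hsH := hH.inflation_surjective (k := ℂ)
  -- Both kernels are images of transgression, and `hcomm` with the bijectivity of `i` identifies
  -- these images under `φ`.
  have hker : (inflation (R := ℂ) (derivedInter G₁ G₂)).ker.map (φ : _ →+ _) =
      (inflation (R := ℂ) (derivedInter H₁ H₂)).ker := by
    ext c
    rw [AddMonoidHom.mem_ker, inflation_eq_zero_iff hH.derivedInter_le_center]
    constructor
    · rintro ⟨b, hb, rfl⟩
      obtain ⟨χ, rfl⟩ := (inflation_eq_zero_iff hG.derivedInter_le_center b).1 hb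
      exact ⟨i χ, (hcomm χ).symm⟩
    · rintro ⟨χ, rfl⟩
      refine ⟨transgression hG.derivedInter_le_center (i.symm χ),
        inflation_transgression hG.derivedInter_le_center _, ?_⟩
      exact (hcomm _).trans (by rw [i.apply_symm_apply])
  let Φ : H2 (unitsRep ℂ G) ≃+ H2 (unitsRep ℂ H) :=
    (QuotientAddGroup.quotientKerEquivOfSurjective _ hsG).symm.trans
      ((QuotientAddGroup.congr _ _ φ hker).trans
        (QuotientAddGroup.quotientKerEquivOfSurjective _ hsH))
  have hΦ : ∀ c, Φ (inflation _ c) = inflation _ (φ c) := fun c => by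
    have : (QuotientAddGroup.quotientKerEquivOfSurjective _ hsG).symm (inflation _ c) =
        (c : _ ⧸ (inflation (R := ℂ) (derivedInter G₁ G₂)).ker) := by
      rw [AddEquiv.symm_apply_eq]
      rfl
    simp only [Φ, AddEquiv.trans_apply, this]
    rfl
  refine ⟨Φ, fun α β hαβ => ?_⟩
  obtain ⟨c, hc⟩ := hsG (H2π _ α)
  obtain ⟨a, rfl⟩ := H2π_surjective c
  -- Representatives downstairs: `α` is cohomologous to the inflation of `a`, and `β` to the
  -- inflation of any `b` representing `φ[a]`.
  obtain ⟨b, hb⟩ := H2π_surjective (φ (H2π _ a))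
  have hβ : H2π _ (inflationCocycle _ b) = H2π _ β := by
    rw [← hαβ, ← hc, hΦ, ← hb, inflation_H2π]
  rw [inflation_H2π] at hc
  obtain ⟨e₁⟩ := TwistedGroupAlgebra.nonempty_algEquiv_of_H2π_eq hc
  obtain ⟨e₂⟩ := TwistedGroupAlgebra.nonempty_algEquiv_of_H2π_eq hβ
  obtain ⟨d₁⟩ := TwistedGroupAlgebra.nonempty_algEquiv_pi hG.derivedInter_le_center a
  obtain ⟨d₂⟩ := TwistedGroupAlgebra.nonempty_algEquiv_pi hH.derivedInter_le_center b
  -- The hypothesis on `φ` is applied to every translate of `a`, since `φ[a + tra χ] = [b + tra (i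
  -- χ)]`; reindexing along `i` then matches the two products.
  have e : ∀ χ, Nonempty (_ ≃ₐ[ℂ] _) := fun χ => hφ
    (a + transgressionCocycle hG.derivedInter_le_center Quotient.out QuotientGroup.out_eq' χ)
    (b + transgressionCocycle hH.derivedInter_le_center Quotient.out QuotientGroup.out_eq' (i χ))
    (by
      rw [_root_.map_add, _root_.map_add, _root_.map_add, hb]
      exact congrArg _ (hcomm χ))
  exact ⟨e₁.symm.trans <| d₁.trans <| (AlgEquiv.piCongrRight fun χ => (e χ).some).trans <|
    (AlgEquiv.piCongrLeft ℂ (fun χ => TwistedGroupAlgebra (b + transgressionCocycle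
      hH.derivedInter_le_center Quotient.out QuotientGroup.out_eq' χ)) i.toEquiv).trans <|
    d₂.symm.trans e₂⟩
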